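/- Let $k$ be an algebraically closed field (for instance $k=\mathbb{C}$), let $X$ and $Y$ be irreducible affine algebraic varieties over $k$, and let $\rho : X \to Y$, $f : X \to X$ and $g : Y \to Y$ be morphisms of varieties over $k$ such that $\rho$ is dominant and $\rho \circ f = g \circ \rho$. Call a morphism birational if it restricts to an isomorphism from a dense open subset of its source onto a dense open subset of its target. Then: (a) if $f$ is birational, then $g$ is birational; (b) if $\dim X = \dim Y$ and $g$ is birational, then $f$ is birational. -/

import Mathlib

open CategoryTheory AlgebraicGeometry

universe u

/-- A morphism of schemes `f : X ⟶ Y` is birational if it restricts to an isomorphism from a dense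
open subscheme of `X` onto a dense open subscheme of `Y`. -/
def IsBirationalMorphism {X Y : Scheme.{u}} (f : X ⟶ Y) : Prop :=
  ∃ φ : Scheme.PartialIso X Y, φ.iso.hom ≫ φ.target.ι = φ.source.ι ≫ f

/-- `X`, with its given structure morphism to `Spec k`, is an irreducible affine algebraic variety
over the field `k`: an integral (reduced, irreducible, nonempty) affine scheme of finite type
over `k`. -/
structure IsIrredAffineVariety (k : Type u) [Field k] (X : Scheme.{u})
    [X.Over (Spec (CommRingCat.of k))] : Prop where
  isAffine : IsAffine X
  isIntegral : IsIntegral X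
  locallyOfFiniteType : LocallyOfFiniteType (X ↘ Spec (CommRingCat.of k))

/-! Birationality can be tested on function fields. Let K = k(X) and L = k(Y); dominance of `ρ`
embeds L in K. Once injective on coordinate rings, `f` and `g` induce endomorphisms φ of K and ψ of
L with φ|L = ψ, and birational means surjective. Both parts count degrees. (a) Finite transcendence
degree makes L algebraic over ψ(L), so L and ψ(L) have the same algebraic closure A in K and φ(A) =
A. As K is finitely generated, [A : L] is finite, and [A : L] = [φ(A) : φ(L)] = [A : L][L : ψ(L)]
forces ψ(L) = L (`AlgHom.surjective_of_surjective_extension`). (b) Equal dimensions make K finite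
over L, and φ(L) = L. Then [K : L] = [K : φ(K)][φ(K) : φ(L)] = [K : φ(K)][K : L] forces φ(K) = K
(`RingHom.surjective_of_surjective_restriction`). -/

/-! ### Degree arguments for field endomorphisms. -/

section FieldTheory

/-- Elements that are algebraic and linearly independent over `K` stay linearly independent over
the subalgebra generated by an algebraically independent family. -/
theorem AlgebraicIndependent.linearIndependent_adjoin {K L ι κ : Type*} [Field K] [Field L]
    [Algebra K L] {t : ι → L} (ht : AlgebraicIndependent K t) (E : IntermediateField K L)
    [Algebra.IsAlgebraic K E] {b : κ → E} (hb : LinearIndependent K b) :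
    LinearIndependent (Algebra.adjoin K (Set.range t)) fun j ↦ (b j : L) := by
  have htE : AlgebraicIndependent E t := ht.extendScalars E
  rw [linearIndependent_iff']
  intro s c hc
  have hex : ∀ j, ∃ p : MvPolynomial ι K, MvPolynomial.aeval t p = (c j : L) := by
    intro j
    exact (Algebra.adjoin_range_eq_range_aeval K t).le (c j).2
  choose p hp using hex
  -- `t` is still algebraically independent over `E`, so the relation is a polynomial identity; its
  -- coefficients are `K`-linear relations among the `b j`.
  have key : ∑ j ∈ s, MvPolynomial.C (b j) * MvPolynomial.map (algebraMap K E) (p j) = 0 := by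
    apply algebraicIndependent_iff_injective_aeval.1 htE
    simp only [map_sum, map_mul, MvPolynomial.aeval_C, MvPolynomial.aeval_map_algebraMap, hp,
      map_zero]
    rw [← hc]
    refine Finset.sum_congr rfl fun j _ ↦ ?_
    rw [Algebra.smul_def, mul_comm]
    rfl
  have hp0 : ∀ j ∈ s, p j = 0 := by
    intro j hj
    ext m
    have hm : ∑ j ∈ s, (p j).coeff m • b j = 0 := by
      have := congrArg (MvPolynomial.coeff m) key
      simp only [MvPolynomial.coeff_sum, MvPolynomial.coeff_C_mul, MvPolynomial.coeff_map,
        MvPolynomial.coeff_zero] at this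
      rw [← this]
      refine Finset.sum_congr rfl fun j _ ↦ ?_
      rw [Algebra.smul_def, mul_comm]
    simpa using linearIndependent_iff'.1 hb s _ hm j hj
  intro j hj
  apply Subtype.ext
  rw [← hp, hp0 j hj]
  simp

open scoped IntermediateField.algebraAdjoinAdjoin in
/-- An algebraic intermediate field of a finitely generated field extension is a finite
extension of the base field. -/
theorem IntermediateField.finiteDimensional_of_isAlgebraic {K L : Type*} [Field K] [Field L]
    [Algebra K L] [Algebra.EssFiniteType K L] (E : IntermediateField K L)
    [Algebra.IsAlgebraic K E] : FiniteDimensional K E := by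
  obtain ⟨s, hs⟩ := exists_isTranscendenceBasis K L
  let F := IntermediateField.adjoin K (Set.range ((↑) : s → L))
  have : Algebra.IsAlgebraic F L := hs.isAlgebraic_field
  have : Algebra.EssFiniteType F L := .of_comp K F L
  have : Module.Finite F L := Algebra.finite_of_essFiniteType_of_isAlgebraic
  -- A `K`-basis of `E` is independent over `F`, hence finite because `L` is finite over `F`.
  have hli := hs.1.linearIndependent_adjoin E (Module.Free.chooseBasis K E).linearIndependent
  rw [LinearIndependent.iff_fractionRing _ F] at hli
  have := hli.finite
  exact Module.Finite.of_basis (Module.Free.chooseBasis K E)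

/-- An injective endomorphism of an algebra of finite transcendence degree makes it algebraic
over its image. -/
theorem AlgHom.isAlgebraic_fieldRange {k L : Type*} [Field k] [Field L] [Algebra k L]
    [FinTrdeg k L] (ψ : L →ₐ[k] L) : Algebra.IsAlgebraic ψ.fieldRange L := by
  rw [← trdeg_eq_zero_iff]
  have h1 := trdeg_add_eq k ψ.fieldRange (A := L)
  have h2 : Algebra.trdeg k ψ.fieldRange = Algebra.trdeg k L :=
    (AlgEquiv.ofInjectiveField ψ).trdeg_eq.symm
  have h3 := trdeg_lt_aleph0 k L
  rw [h2] at h1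
  -- For cardinals, d + e = d gives e = 0 or d infinite.
  exact (Cardinal.add_eq_left_iff.mp h1).resolve_left (fun h ↦ absurd h3 (not_lt.2
    ((le_max_left _ _).trans h)))

/-- An endomorphism of `L` is surjective if it extends to an automorphism of a field `K` that is
finitely generated over the base field: it preserves the finite degree over `L` of the algebraic
closure of `L` in `K`. -/
theorem AlgHom.surjective_of_surjective_extension {k L K : Type*} [Field k] [Field L] [Field K]
    [Algebra k L] [Algebra k K] [Algebra L K] [IsScalarTower k L K] [Algebra.EssFiniteType k K]
    {φ : K →+* K} (hφ : Function.Surjective φ) (ψ : L →ₐ[k] L)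
    (h : ∀ x, φ (algebraMap L K x) = algebraMap L K (ψ x)) : Function.Surjective ψ := by
  have : Algebra.EssFiniteType L K := .of_comp k L K
  have : FinTrdeg k L := by
    rw [finTrdeg_iff_trdeg, ← Cardinal.lift_lt_aleph0]
    refine lt_of_le_of_lt (lift_trdeg_le_of_injective (IsScalarTower.toAlgHom k L K)
      (algebraMap L K).injective) ?_
    rw [Cardinal.lift_lt_aleph0]
    exact trdeg_lt_aleph0 k K
  have : Algebra.IsAlgebraic ψ.fieldRange L := ψ.isAlgebraic_fieldRange
  have := (algebraicClosure L K).finiteDimensional_of_isAlgebraic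
  set S : Subfield K := (algebraMap L K).fieldRange
  set A : Subfield K := (algebraicClosure L K).toSubfield
  have hSA : S.relfinrank A ≠ 0 := by
    have := IntermediateField.relfinrank_bot_left (algebraicClosure L K)
    rw [IntermediateField.relfinrank, IntermediateField.bot_toSubfield] at this
    rw [this]
    exact Module.finrank_pos.ne'
  -- `φ` carries `L` onto `ψ.fieldRange`, over which `L` is algebraic.
  have hmem : ∀ x, φ x ∈ A ↔ x ∈ A := by
    intro x
    let e : L ≃+* ψ.fieldRange := (AlgEquiv.ofInjectiveField ψ).toRingEquiv
    have hc : (algebraMap ψ.fieldRange K).comp (e : L →+* ψ.fieldRange) =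
        φ.comp (algebraMap L K) :=
      RingHom.ext fun z ↦ (h z).symm
    have h1 : IsAlgebraic ψ.fieldRange (φ x) ↔ IsAlgebraic L (φ x) :=
      ⟨fun hx ↦ hx.extendScalars (algebraMap ψ.fieldRange L).injective,
        fun hx ↦ hx.restrictScalars ψ.fieldRange⟩
    have h2 : x ∈ A ↔ IsAlgebraic L x := mem_algebraicClosure_iff
    have h3 : φ x ∈ A ↔ IsAlgebraic L (φ x) := mem_algebraicClosure_iff
    rw [h2, h3, ← h1]
    exact isAlgebraic_ringHom_iff_of_comp_eq (e : L ≃+* ψ.fieldRange) φ φ.injective hc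
  have hAA : A.map φ = A := by
    ext y
    constructor
    · rintro ⟨x, hx, rfl⟩
      exact (hmem x).2 hx
    · intro hy
      obtain ⟨x, rfl⟩ := hφ y
      exact ⟨x, (hmem x).1 hy, rfl⟩
  have hSS : S.map φ ≤ S := by
    rintro _ ⟨_, ⟨x, rfl⟩, rfl⟩
    exact ⟨ψ x, (h x).symm⟩
  have hSleA : S ≤ A := by
    rintro _ ⟨x, rfl⟩
    exact (algebraicClosure L K).algebraMap_mem x
  have h1 := Subfield.relfinrank_mul_relfinrank hSS hSleA
  have h2 : (S.map φ).relfinrank A = S.relfinrank A := by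
    conv_lhs => rw [← hAA]
    exact Subfield.relfinrank_map_map S A φ
  rw [h2] at h1
  have h3 := Subfield.relfinrank_eq_one_iff.1 (Nat.eq_of_mul_eq_mul_right (Nat.pos_of_ne_zero hSA)
    (h1.trans (one_mul _).symm))
  intro y
  obtain ⟨_, ⟨x, rfl⟩, hx⟩ := h3 ⟨y, rfl⟩
  exact ⟨x, (algebraMap L K).injective (by rw [← h, hx])⟩

/-- An endomorphism of a finite extension of `L` is surjective if it restricts to an automorphism
of `L`. -/
theorem RingHom.surjective_of_surjective_restriction {L K : Type*} [Field L] [Field K]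
    [Algebra L K] [FiniteDimensional L K] (φ : K →+* K) {ψ : L →+* L}
    (hψ : Function.Surjective ψ)
    (h : ∀ x, φ (algebraMap L K x) = algebraMap L K (ψ x)) : Function.Surjective φ := by
  set S : Subfield K := (algebraMap L K).fieldRange
  have hST : S.relfinrank ⊤ ≠ 0 := by
    have := IntermediateField.relfinrank_bot_left (⊤ : IntermediateField L K)
    rw [IntermediateField.relfinrank, IntermediateField.bot_toSubfield,
      IntermediateField.top_toSubfield] at this
    rw [this]
    exact Module.finrank_pos.ne'
  have hSS : S.map φ = S := by
    ext y
    constructor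
    · rintro ⟨_, ⟨x, rfl⟩, rfl⟩
      exact ⟨ψ x, (h x).symm⟩
    · rintro ⟨x, rfl⟩
      obtain ⟨x, rfl⟩ := hψ x
      exact ⟨_, ⟨x, rfl⟩, h x⟩
  have hle : S ≤ Subfield.map φ ⊤ := by
    conv_lhs => rw [← hSS]
    rintro _ ⟨x, -, rfl⟩
    exact ⟨x, Subfield.mem_top x, rfl⟩
  have h1 := Subfield.relfinrank_mul_relfinrank hle (le_top (a := Subfield.map φ ⊤))
  have h2 : S.relfinrank (Subfield.map φ ⊤) = S.relfinrank ⊤ := by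
    conv_lhs => rw [← hSS]
    exact Subfield.relfinrank_map_map S ⊤ φ
  rw [h2] at h1
  have h3 := Subfield.relfinrank_eq_one_iff.1 (Nat.eq_of_mul_eq_mul_left (Nat.pos_of_ne_zero hST)
    (h1.trans (mul_one _).symm))
  intro y
  obtain ⟨x, -, hx⟩ := h3 (Subfield.mem_top y)
  exact ⟨x, hx⟩

end FieldTheory

/-! ### Krull dimension and transcendence degree. -/

section KrullDimension

/-- Incomparability makes contraction of primes strictly monotone; lying over and going up lift
chains without changing their length. -/
theorem ringKrullDim_eq_of_isIntegral_of_injective {A B : Type*} [CommRing A] [CommRing B]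
    [Algebra A B] [Algebra.IsIntegral A B] (h : Function.Injective (algebraMap A B)) :
    ringKrullDim B = ringKrullDim A := by
  apply le_antisymm
  · exact Order.krullDim_le_of_strictMono (PrimeSpectrum.comap (algebraMap A B))
      fun I J hIJ ↦ Ideal.IsIntegral.comap_lt_comap (R := A) hIJ
  · refine iSup_le fun l ↦ ?_
    obtain ⟨Q, hQ, hQl⟩ := Ideal.exists_ideal_over_prime_of_isIntegral (S := B)
      l.head.asIdeal ⊥ (by
        rw [← RingHom.ker_eq_comap_bot, (RingHom.injective_iff_ker_eq_bot _).1 h]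
        exact bot_le)
    have : Q.LiesOver l.head.asIdeal := ⟨hQl.2.symm⟩
    have := hQl.1
    obtain ⟨m, hm, -⟩ := Ideal.exists_ltSeries_of_hasGoingUp (S := B) l Q
    rw [← hm]
    exact le_iSup (fun p : LTSeries (PrimeSpectrum B) ↦ ((p.length : ℕ∞) : WithBot ℕ∞)) m

/-- The Krull dimension of an affine domain is the transcendence degree of its field of
fractions. -/
theorem exists_ringKrullDim_eq_trdeg (k B : Type*) [Field k] [CommRing B] [IsDomain B]
    [Algebra k B] [Algebra.FiniteType k B] :
    ∃ n : ℕ, ringKrullDim B = n ∧ Algebra.trdeg k B = n := by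
  -- Noether normalization: both invariants equal the number `n` of variables.
  obtain ⟨n, g, hg, hint⟩ := exists_integral_inj_algHom_of_fg k B
  refine ⟨n, ?_, ?_⟩
  · algebraize [g.toRingHom]
    rw [ringKrullDim_eq_of_isIntegral_of_injective (A := MvPolynomial (Fin n) k) hg,
      MvPolynomial.ringKrullDim_of_isNoetherianRing, ringKrullDim_eq_zero_of_field]
    simp
  · algebraize [g.toRingHom]
    have : IsScalarTower k (MvPolynomial (Fin n) k) B :=
      .of_algebraMap_eq fun x ↦ (g.commutes x).symm
    have : FaithfulSMul (MvPolynomial (Fin n) k) B :=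
      (faithfulSMul_iff_algebraMap_injective _ _).2 hg
    have h := lift_trdeg_add_eq k (MvPolynomial (Fin n) k) B
    rw [(trdeg_eq_zero_iff (R := MvPolynomial (Fin n) k) (A := B)).2 inferInstance,
      MvPolynomial.trdeg_of_isDomain] at h
    simpa using h.symm

/-- An injective homomorphism of affine domains of equal Krull dimension is algebraic. -/
theorem isAlgebraic_of_ringKrullDim_eq (k : Type*) {A B : Type*} [Field k] [CommRing A]
    [CommRing B] [IsDomain A] [IsDomain B] [Algebra k A] [Algebra k B] [Algebra A B]
    [IsScalarTower k A B] [FaithfulSMul A B] [Algebra.FiniteType k A] [Algebra.FiniteType k B]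
    (h : ringKrullDim B = ringKrullDim A) : Algebra.IsAlgebraic A B := by
  obtain ⟨m, hm, hm'⟩ := exists_ringKrullDim_eq_trdeg k A
  obtain ⟨n, hn, hn'⟩ := exists_ringKrullDim_eq_trdeg k B
  obtain rfl : n = m := by
    rw [hn, hm] at h
    exact_mod_cast h
  have := lift_trdeg_add_eq k A B
  rw [hm', hn'] at this
  rw [← trdeg_eq_zero_iff]
  have h0 : Cardinal.lift (Algebra.trdeg A B) = 0 := by
    refine Cardinal.eq_of_add_eq_add_left (a := (n : Cardinal)) ?_ Cardinal.natCast_lt_aleph0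
    simpa using this
  simpa using h0

end KrullDimension

/-! ### Birational homomorphisms of domains. -/

section Birational

/-- A ring homomorphism is birational if it is injective and every element of the target becomes,
after multiplication by the image of some nonzero element, an element of the image. For domains
this says that it induces an isomorphism of fraction fields. -/
def RingHom.IsBirational {A B : Type*} [CommRing A] [CommRing B] (φ : A →+* B) : Prop :=
  Function.Injective φ ∧ ∀ b, ∃ s a, s ≠ 0 ∧ φ s * b = φ a

variable {k A B : Type*} [Field k] [CommRing A] [CommRing B] [IsDomain A] [IsDomain B]
  [Algebra k A] [Algebra k B]

/-- The extension of an injective homomorphism of domains to their fraction fields. -/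
noncomputable def AlgHom.mapFractionRing (φ : A →ₐ[k] B) (hφ : Function.Injective φ) :
    FractionRing A →ₐ[k] FractionRing B :=
  IsFractionRing.liftAlgHom (g := (IsScalarTower.toAlgHom k B (FractionRing B)).comp φ)
    ((IsFractionRing.injective B (FractionRing B)).comp hφ)

theorem AlgHom.mapFractionRing_algebraMap (φ : A →ₐ[k] B) (hφ : Function.Injective φ) (a : A) :
    φ.mapFractionRing hφ (algebraMap A (FractionRing A) a) =
      algebraMap B (FractionRing B) (φ a) :=
  IsFractionRing.lift_algebraMap (g := (algebraMap B (FractionRing B)).comp (φ : A →+* B))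
    ((IsFractionRing.injective B (FractionRing B)).comp hφ) a

theorem AlgHom.isBirational_iff (φ : A →ₐ[k] B) (hφ : Function.Injective φ) :
    (φ : A →+* B).IsBirational ↔ Function.Surjective (φ.mapFractionRing hφ) := by
  constructor
  · intro h y
    have hB : ∀ b : B, ∃ x, φ.mapFractionRing hφ x = algebraMap B (FractionRing B) b := by
      intro b
      obtain ⟨s, a, hs, hsa⟩ := h.2 b
      have hs' : algebraMap B (FractionRing B) (φ s) ≠ 0 := by
        simpa using (map_ne_zero_iff φ hφ).2 hs
      refine ⟨algebraMap A _ a / algebraMap A _ s, ?_⟩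
      rw [map_div₀, mapFractionRing_algebraMap, mapFractionRing_algebraMap, div_eq_iff hs',
        ← map_mul, mul_comm b]
      exact congrArg _ hsa.symm
    obtain ⟨b, c, -, rfl⟩ := IsFractionRing.div_surjective (A := B) y
    obtain ⟨x, hx⟩ := hB b
    obtain ⟨z, hz⟩ := hB c
    exact ⟨x / z, by rw [map_div₀, hx, hz]⟩
  · intro h
    refine ⟨hφ, fun b ↦ ?_⟩
    obtain ⟨x, hx⟩ := h (algebraMap B _ b)
    obtain ⟨a, s, hs, rfl⟩ := IsFractionRing.div_surjective (A := A) x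
    have hs0 := nonZeroDivisors.ne_zero hs
    have hs' : algebraMap B (FractionRing B) (φ s) ≠ 0 := by
      simpa using (map_ne_zero_iff φ hφ).2 hs0
    rw [map_div₀, mapFractionRing_algebraMap, mapFractionRing_algebraMap, div_eq_iff hs',
      ← map_mul] at hx
    refine ⟨s, a, hs0, ?_⟩
    rw [mul_comm]
    exact (IsFractionRing.injective B (FractionRing B) hx).symm

theorem AlgHom.mapFractionRing_comm (r : A →ₐ[k] B) (hr : Function.Injective r)
    (φ : B →ₐ[k] B) (hφ : Function.Injective φ) (γ : A →ₐ[k] A) (hγ : Function.Injective γ)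
    (h : φ.comp r = r.comp γ) (x : FractionRing A) :
    φ.mapFractionRing hφ (r.mapFractionRing hr x) =
      r.mapFractionRing hr (γ.mapFractionRing hγ x) := by
  obtain ⟨a, s, -, rfl⟩ := IsFractionRing.div_surjective (A := A) x
  simp only [map_div₀, mapFractionRing_algebraMap]
  have := fun a ↦ DFunLike.congr_fun h a
  simp only [AlgHom.comp_apply] at this
  rw [this, this]

/-- Birationality of an endomorphism of an affine domain descends to a subalgebra. -/
theorem AlgHom.isBirational_of_extension [Algebra.FiniteType k B] (r : A →ₐ[k] B)
    (hr : Function.Injective r) (φ : B →ₐ[k] B) (γ : A →ₐ[k] A) (h : φ.comp r = r.comp γ)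
    (hφ : (φ : B →+* B).IsBirational) : (γ : A →+* A).IsBirational := by
  have hγ : Function.Injective γ := by
    have : Function.Injective (r.comp γ) := h ▸ hφ.1.comp hr
    exact Function.Injective.of_comp this
  rw [γ.isBirational_iff hγ]
  algebraize [(r.mapFractionRing hr).toRingHom]
  have : IsScalarTower k (FractionRing A) (FractionRing B) :=
    .of_algebraMap_eq fun x ↦ ((r.mapFractionRing hr).commutes x).symm
  have : Algebra.EssFiniteType k (FractionRing B) := .comp k B _
  exact AlgHom.surjective_of_surjective_extension
    (φ := (φ.mapFractionRing hφ.1 : FractionRing B →+* FractionRing B))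
    ((φ.isBirational_iff hφ.1).1 hφ) _ (r.mapFractionRing_comm hr φ hφ.1 γ hγ h)

/-- Birationality of an endomorphism of an affine domain ascends to an affine domain of the same
dimension. -/
theorem AlgHom.isBirational_of_restriction [Algebra.FiniteType k A] [Algebra.FiniteType k B]
    (hdim : ringKrullDim B = ringKrullDim A) (r : A →ₐ[k] B)
    (hr : Function.Injective r) (φ : B →ₐ[k] B) (γ : A →ₐ[k] A) (h : φ.comp r = r.comp γ)
    (hγ : (γ : A →+* A).IsBirational) : (φ : B →+* B).IsBirational := by
  algebraize [r.toRingHom]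
  have : IsScalarTower k A B := .of_algebraMap_eq fun x ↦ (r.commutes x).symm
  have : FaithfulSMul A B := (faithfulSMul_iff_algebraMap_injective _ _).2 hr
  have hAB : Algebra.IsAlgebraic A B := isAlgebraic_of_ringKrullDim_eq k hdim
  have hφ : Function.Injective φ := by
    rw [injective_iff_map_eq_zero]
    intro b hb
    by_contra hb0
    -- A nonzero algebraic `b` divides some nonzero `a` from `A`, so `φ b = 0` would kill `r a`,
    -- although `r` and `γ` are injective.
    obtain ⟨a, ha, c, hc⟩ := (hAB.isAlgebraic b).exists_nonzero_dvd
      (mem_nonZeroDivisors_of_ne_zero hb0)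
    have : r (γ a) = 0 := by
      have h' : φ (r a) = r (γ a) := DFunLike.congr_fun h a
      rw [← h', show r a = b * c from hc, map_mul, hb, zero_mul]
    exact ha (hγ.1 (hr (by simpa using this)))
  rw [φ.isBirational_iff hφ]
  algebraize [(r.mapFractionRing hr).toRingHom]
  have : IsScalarTower k (FractionRing A) (FractionRing B) :=
    .of_algebraMap_eq fun x ↦ ((r.mapFractionRing hr).commutes x).symm
  have : IsScalarTower A (FractionRing A) (FractionRing B) :=
    .of_algebraMap_eq fun x ↦ (r.mapFractionRing_algebraMap hr x).symm
  have : Algebra.EssFiniteType k (FractionRing B) := .comp k B _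
  have : Algebra.EssFiniteType (FractionRing A) (FractionRing B) := .of_comp k _ _
  have : Algebra.IsAlgebraic B (FractionRing B) := IsLocalization.isAlgebraic _ (nonZeroDivisors B)
  have : Algebra.IsAlgebraic A (FractionRing B) := .trans A B _
  have : Algebra.IsAlgebraic (FractionRing A) (FractionRing B) := .extendScalars
    (IsFractionRing.injective A (FractionRing A))
  have : FiniteDimensional (FractionRing A) (FractionRing B) :=
    Algebra.finite_of_essFiniteType_of_isAlgebraic
  exact RingHom.surjective_of_surjective_restriction
    (φ.mapFractionRing hφ : FractionRing B →+* FractionRing B)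
    (ψ := (γ.mapFractionRing hγ.1 : FractionRing A →+* FractionRing A))
    ((γ.isBirational_iff hγ.1).1 hγ) (r.mapFractionRing_comm hr φ hφ γ hγ.1 h)

/-- A birational homomorphism of finite type becomes surjective after inverting one nonzero
element. -/
theorem RingHom.IsBirational.exists_pow_mul_mem_range {A B : Type*} [CommRing A] [CommRing B]
    [IsDomain A] {φ : A →+* B} (h : φ.IsBirational) (hfin : φ.FiniteType) :
    ∃ s, s ≠ 0 ∧ ∀ b, ∃ (n : ℕ) (a : A), φ s ^ n * b = φ a := by
  classical
  algebraize [φ]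
  obtain ⟨t, ht⟩ := Algebra.FiniteType.out (R := A) (A := B)
  choose s a hs hsa using h.2
  -- A common denominator for the finitely many generators.
  refine ⟨∏ b ∈ t, s b, Finset.prod_ne_zero_iff.2 fun b _ ↦ hs b, fun b ↦ ?_⟩
  have hb : b ∈ Algebra.adjoin A (t : Set B) := ht ▸ Algebra.mem_top
  induction hb using Algebra.adjoin_induction with
  | mem x hx =>
    refine ⟨1, (∏ b ∈ t.erase x, s b) * a x, ?_⟩
    rw [← Finset.prod_erase_mul t s hx, pow_one, map_mul, map_mul, mul_assoc, hsa]
  | algebraMap x => exact ⟨0, x, by simp [RingHom.algebraMap_toAlgebra]⟩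
  | add x y _ _ hx hy =>
    obtain ⟨m, c, hc⟩ := hx
    obtain ⟨n, d, hd⟩ := hy
    refine ⟨m + n, (∏ b ∈ t, s b) ^ n * c + (∏ b ∈ t, s b) ^ m * d, ?_⟩
    rw [map_add, map_mul, map_mul, ← hc, ← hd, map_pow, map_pow]
    ring
  | mul x y _ _ hx hy =>
    obtain ⟨m, c, hc⟩ := hx
    obtain ⟨n, d, hd⟩ := hy
    refine ⟨m + n, c * d, ?_⟩
    rw [map_mul, ← hc, ← hd]
    ring

end Birational

/-! ### Birational morphisms and global sections. -/

section Geometry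

variable {X Y : Scheme.{u}}

theorem AlgebraicGeometry.Scheme.Hom.appTop_injective_of_isDominant [IsReduced Y] (f : X ⟶ Y)
    [IsDominant f] [QuasiCompact f] : Function.Injective f.appTop := by
  have := IsSchemeTheoreticallyDominant.of_isDominant f
  exact f.app_injective ⊤

theorem AlgebraicGeometry.Scheme.Hom.isIso_stalkMap_of_isOpenImmersion_comp {U : Scheme.{u}}
    (f : X ⟶ Y) (i : U ⟶ X) [IsOpenImmersion i] [IsOpenImmersion (i ≫ f)] (x : U) :
    IsIso (f.stalkMap (i x)) :=
  have : IsIso (f.stalkMap (i x) ≫ i.stalkMap x) := by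
    have h : IsIso ((i ≫ f).stalkMap x) := inferInstance
    rwa [Scheme.Hom.stalkMap_comp] at h
  IsIso.of_isIso_comp_right (f.stalkMap (i x)) (i.stalkMap x)

/-- A birational morphism to an affine integral scheme is birational on global sections. -/
theorem IsBirationalMorphism.isBirational_appTop [IsIntegral X] [IsIntegral Y] [IsAffine Y]
    {f : X ⟶ Y} (hf : IsBirationalMorphism f) : f.appTop.hom.IsBirational := by
  obtain ⟨φ, hφ⟩ := hf
  obtain ⟨x, hx : x ∈ φ.source⟩ := φ.dense_source.nonempty
  have hiso : IsIso (f.stalkMap x) := by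
    have : IsOpenImmersion (φ.source.ι ≫ f) := hφ ▸ inferInstance
    exact f.isIso_stalkMap_of_isOpenImmersion_comp φ.source.ι ⟨x, hx⟩
  have hbij := (ConcreteCategory.isIso_iff_bijective (f.stalkMap x)).1 hiso
  have hgerm : ∀ s : Γ(Y, ⊤), f.stalkMap x (Y.presheaf.germ ⊤ (f x) trivial s) =
      X.presheaf.germ ⊤ x trivial (f.appTop s) := fun s ↦
    Scheme.Hom.germ_stalkMap_apply f ⊤ x trivial s
  refine ⟨?_, fun b ↦ ?_⟩
  · intro s t hst
    apply germ_injective_of_isIntegral Y (f x) (U := ⊤) trivial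
    apply hbij.1
    rw [hgerm, hgerm]
    exact congrArg _ hst
  · obtain ⟨c, hc⟩ := hbij.2 (X.presheaf.germ ⊤ x trivial b)
    let := Y.presheaf.algebra_section_stalk (⟨f x, trivial⟩ : (⊤ : Y.Opens))
    have := (isAffineOpen_top Y).isLocalization_stalk ⟨f x, trivial⟩
    obtain ⟨⟨a, s⟩, has⟩ := IsLocalization.surj
      ((isAffineOpen_top Y).primeIdealOf ⟨f x, trivial⟩).asIdeal.primeCompl c
    refine ⟨s, a, ?_, ?_⟩
    · rintro h
      exact s.2 (h ▸ Ideal.zero_mem _)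
    · apply germ_injective_of_isIntegral X x (U := ⊤) trivial
      have has' : c * Y.presheaf.germ ⊤ (f x) trivial s = Y.presheaf.germ ⊤ (f x) trivial a := has
      have := congrArg (f.stalkMap x) has'
      rw [map_mul, hgerm, hgerm, hc] at this
      rw [map_mul, mul_comm]
      exact this

/-- Sections over the preimage of `Y.basicOpen s` are fractions with denominator a power of
`f.appTop s`, and `s` is invertible on `Y.basicOpen s`. -/
theorem AlgebraicGeometry.Scheme.Hom.app_basicOpen_surjective [IsAffine X] [IsAffine Y]
    {f : X ⟶ Y} {s : Γ(Y, ⊤)} (h : ∀ b, ∃ (n : ℕ) (a : Γ(Y, ⊤)), f.appTop s ^ n * b = f.appTop a) :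
    Function.Surjective (f.app (Y.basicOpen s)) := by
  intro y
  let iY : Y.basicOpen s ⟶ ⊤ := homOfLE le_top
  let iX : f ⁻¹ᵁ Y.basicOpen s ⟶ ⊤ := homOfLE le_top
  have hnat : ∀ a : Γ(Y, ⊤), f.app (Y.basicOpen s) (Y.presheaf.map iY.op a) =
      X.presheaf.map iX.op (f.appTop a) := fun a ↦
    ConcreteCategory.congr_hom (f.naturality iY.op) a
  let := (X.presheaf.map iX.op).hom.toAlgebra
  have hloc : IsLocalization.Away (f.appTop s) Γ(X, f ⁻¹ᵁ Y.basicOpen s) :=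
    (isAffineOpen_top X).isLocalization_of_eq_basicOpen (f.appTop s) iX
      (f.preimage_basicOpen s)
  obtain ⟨⟨b, ⟨_, n, rfl⟩⟩, hb⟩ := IsLocalization.surj (Submonoid.powers (f.appTop s)) y
  obtain ⟨m, a, ha⟩ := h b
  obtain ⟨u, hu⟩ : IsUnit (Y.presheaf.map iY.op s) :=
    RingedSpace.isUnit_res_basicOpen Y.toLocallyRingedSpace.toRingedSpace s
  have hb' : y * X.presheaf.map iX.op (f.appTop s) ^ n = X.presheaf.map iX.op b := by
    rw [← map_pow]
    exact hb
  -- With σ the restriction of `f.appTop s`, `y` σ^n is `b` and σ^m `b` is the image of `a`, so `y`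
  -- is that image over σ^(n+m).
  refine ⟨Y.presheaf.map iY.op a * ↑(u⁻¹ ^ (n + m)), ?_⟩
  have hunit : f.app (Y.basicOpen s) ↑(u⁻¹ ^ (n + m)) *
      X.presheaf.map iX.op (f.appTop s) ^ (n + m) = 1 := by
    rw [← hnat, ← map_pow, ← map_mul, ← hu, ← Units.val_pow_eq_pow_val, ← Units.val_mul]
    simp
  rw [map_mul, hnat, ← ha, map_mul, map_pow, ← hb']
  linear_combination y * hunit

theorem AlgebraicGeometry.Scheme.Hom.app_injective_of_appTop_injective [IsAffine X] [IsAffine Y]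
    [IsReduced Y] {f : X ⟶ Y} (h : Function.Injective f.appTop) (U : Y.Opens) :
    Function.Injective (f.app U) := by
  have := isDominant_of_of_appTop_injective h
  have := IsSchemeTheoreticallyDominant.of_isDominant f
  exact f.app_injective U

/-- A morphism of finite type between affine integral schemes is birational if it is so on global
sections. -/
theorem isBirationalMorphism_of_isBirational_appTop [IsIntegral X] [IsIntegral Y] [IsAffine X]
    [IsAffine Y] {f : X ⟶ Y} [LocallyOfFiniteType f] (hf : f.appTop.hom.IsBirational) :
    IsBirationalMorphism f := by
  obtain ⟨s, hs, hmul⟩ := hf.exists_pow_mul_mem_range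
    ((HasRingHomProperty.iff_of_isAffine (P := @LocallyOfFiniteType)).1 inferInstance)
  have hiso : IsIso (f ∣_ Y.basicOpen s) := by
    rw [isIso_morphismRestrict_iff_isIso_app f ((isAffineOpen_top Y).basicOpen s),
      ConcreteCategory.isIso_iff_bijective]
    exact ⟨Scheme.Hom.app_injective_of_appTop_injective hf.1 _,
      Scheme.Hom.app_basicOpen_surjective hmul⟩
  have hdense : ∀ {Z : Scheme.{u}} [IsIntegral Z] {t : Γ(Z, ⊤)}, t ≠ 0 →
      Dense (Z.basicOpen t : Set Z) := by
    intro Z _ t ht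
    refine (Z.basicOpen t).isOpen.dense ?_
    rw [Set.nonempty_iff_ne_empty]
    intro h
    exact ht ((basicOpen_eq_bot_iff t).1 (SetLike.coe_injective h))
  refine ⟨⟨f ⁻¹ᵁ Y.basicOpen s, ?_, Y.basicOpen s, hdense hs, asIso (f ∣_ Y.basicOpen s)⟩,
    morphismRestrict_ι _ _⟩
  rw [f.preimage_basicOpen s]
  exact hdense ((map_ne_zero_iff f.appTop.hom hf.1).2 hs)

/-- The homomorphism from the base field to the global sections of a scheme over it. -/
noncomputable def globalSectionsMap (k : Type u) [Field k] (X : Scheme.{u})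
    [X.Over (Spec (CommRingCat.of k))] : CommRingCat.of k ⟶ Γ(X, ⊤) :=
  (Scheme.ΓSpecIso (CommRingCat.of k)).inv ≫ (X ↘ Spec (CommRingCat.of k)).appTop

theorem globalSectionsMap_appTop (k : Type u) [Field k] [X.Over (Spec (CommRingCat.of k))]
    [Y.Over (Spec (CommRingCat.of k))] (f : X ⟶ Y) [f.IsOver (Spec (CommRingCat.of k))] :
    globalSectionsMap k Y ≫ f.appTop = globalSectionsMap k X := by
  rw [globalSectionsMap, globalSectionsMap, Category.assoc, ← Scheme.Hom.comp_appTop, comp_over]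

theorem finiteType_globalSectionsMap (k : Type u) [Field k] (X : Scheme.{u}) [IsAffine X]
    [X.Over (Spec (CommRingCat.of k))] [LocallyOfFiniteType (X ↘ Spec (CommRingCat.of k))] :
    (globalSectionsMap k X).hom.FiniteType := by
  refine RingHom.FiniteType.comp ((HasRingHomProperty.iff_of_isAffine
    (P := @LocallyOfFiniteType)).1 inferInstance) (RingHom.FiniteType.of_surjective _ ?_)
  exact (ConcreteCategory.bijective_of_isIso (Scheme.ΓSpecIso (CommRingCat.of k)).inv).2

end Geometry

/-! ### Translation to coordinate rings. -/

theorem lemma2p2 {k : Type u} [Field k] [IsAlgClosed k]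
    (X Y : Scheme.{u}) [X.Over (Spec (CommRingCat.of k))] [Y.Over (Spec (CommRingCat.of k))]
    (hX : IsIrredAffineVariety k X) (hY : IsIrredAffineVariety k Y)
    (ρ : X ⟶ Y) (f : X ⟶ X) (g : Y ⟶ Y)
    [ρ.IsOver (Spec (CommRingCat.of k))] [f.IsOver (Spec (CommRingCat.of k))]
    [g.IsOver (Spec (CommRingCat.of k))]
    (hρ : IsDominant ρ) (hcomm : f ≫ ρ = ρ ≫ g) :
    (IsBirationalMorphism f → IsBirationalMorphism g) ∧
    (topologicalKrullDim X = topologicalKrullDim Y →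
      IsBirationalMorphism g → IsBirationalMorphism f) := by
  have := hX.isAffine
  have := hY.isAffine
  have := hX.isIntegral
  have := hY.isIntegral
  have := hX.locallyOfFiniteType
  have := hY.locallyOfFiniteType
  have hlft : ∀ {Z W : Scheme.{u}} [Z.Over (Spec (CommRingCat.of k))]
      [W.Over (Spec (CommRingCat.of k))] [LocallyOfFiniteType (Z ↘ Spec (CommRingCat.of k))]
      (h : Z ⟶ W) [h.IsOver (Spec (CommRingCat.of k))], LocallyOfFiniteType h := by
    intro Z W _ _ _ h _
    have : LocallyOfFiniteType (h ≫ W ↘ Spec (CommRingCat.of k)) := by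
      rwa [comp_over]
    exact locallyOfFiniteType_of_comp h (W ↘ Spec (CommRingCat.of k))
  have := hlft f
  have := hlft g
  -- An affine scheme is homeomorphic to the spectrum of its global sections.
  have hdim : ∀ (Z : Scheme.{u}) [IsAffine Z], topologicalKrullDim Z = ringKrullDim Γ(Z, ⊤) := by
    intro Z _
    rw [← PrimeSpectrum.topologicalKrullDim_eq_ringKrullDim]
    exact IsHomeomorph.topologicalKrullDim_eq _ Z.isoSpec.hom.homeomorph.isHomeomorph
  let : Algebra k Γ(X, ⊤) := (globalSectionsMap k X).hom.toAlgebra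
  let : Algebra k Γ(Y, ⊤) := (globalSectionsMap k Y).hom.toAlgebra
  have : Algebra.FiniteType k Γ(X, ⊤) := finiteType_globalSectionsMap k X
  have : Algebra.FiniteType k Γ(Y, ⊤) := finiteType_globalSectionsMap k Y
  let r : Γ(Y, ⊤) →ₐ[k] Γ(X, ⊤) :=
    { ρ.appTop.hom with commutes' := ConcreteCategory.congr_hom (globalSectionsMap_appTop k ρ) }
  let φ : Γ(X, ⊤) →ₐ[k] Γ(X, ⊤) :=
    { f.appTop.hom with commutes' := ConcreteCategory.congr_hom (globalSectionsMap_appTop k f) }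
  let γ : Γ(Y, ⊤) →ₐ[k] Γ(Y, ⊤) :=
    { g.appTop.hom with commutes' := ConcreteCategory.congr_hom (globalSectionsMap_appTop k g) }
  have hr : Function.Injective r := ρ.appTop_injective_of_isDominant
  have hc : φ.comp r = r.comp γ := by
    have : ρ.appTop ≫ f.appTop = g.appTop ≫ ρ.appTop := by
      rw [← Scheme.Hom.comp_appTop, ← Scheme.Hom.comp_appTop, hcomm]
    exact AlgHom.ext (ConcreteCategory.congr_hom this)
  refine ⟨fun hf ↦ ?_, fun hd hg ↦ ?_⟩
  · exact isBirationalMorphism_of_isBirational_appTop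
      (AlgHom.isBirational_of_extension r hr φ γ hc hf.isBirational_appTop)
  · rw [hdim, hdim] at hd
    exact isBirationalMorphism_of_isBirational_appTop
      (AlgHom.isBirational_of_restriction hd r hr φ γ hc hg.isBirational_appTop)
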